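/- **Setting.** Let $M>1$, $T$, $b$, $B'$ be integers with $0\le b<T$ and $0\le B'<M$, put $B=bM+B'$, and let $W\ge M(T+1)$. At each time $i\ge 0$ a source symbol $\mathbf s[i]\in\mathbb F_q^{k}$ arrives and a macro-packet of $M$ channel packets $\mathbf x[i,1],\dots,\mathbf x[i,M]$, depending only on $\mathbf s[0],\dots,\mathbf s[i]$, is sent; channel packets may be erased, and $\mathbf s[i]$ has to be computed from the channel outputs of the macro-packets $0,\dots,i+T$. A systematic $(\bar k+\bar r,\bar k,m)$ convolutional code sends $(\mathbf s[i],\mathbf p[i])$ with $\mathbf p[i]=\sum_{t=0}^m \mathbf s^\dagger[i-t]\mathbf H_t\in\mathbb F_q^{\bar r}$, symbols with negative index being zero. It is Strongly-MDS if for every $j=0,\dots,m$ its (sub-symbol) column distance, the least Hamming weight of the codeword truncated to times $0,\dots,j$ over all inputs with $\mathbf s[0]\ne 0$, has its largest possible value $\bar r(j+1)+1$. **Burst code.** Let $$(n,k^u,k^v)=\begin{cases}(T+b,\;Mb,\;M(T-b)), & B'\le \frac{b}{T+b}M,\\ (T+b+1,\;B,\;M(T+b+1)-2B), & B'>\frac{b}{T+b}M,\end{cases}$$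 $k=k^u+k^v$, and $k^u=rn+r'$ with $0\le r'<n$. Split $\mathbf s[i]=(\mathbf u_{\rm vec}[i],\mathbf v_{\rm vec}[i])\in\mathbb F_q^{k^u}\times\mathbb F_q^{k^v}$, let $\mathbf p_{\rm vec}[i]\in\mathbb F_q^{k^u}$ be the parity checks of a $(k^v+k^u,k^v,T)$ Strongly-MDS code applied to $\mathbf v_{\rm vec}[\cdot]$, and let $\mathbf q_{\rm vec}[i]=\mathbf p_{\rm vec}[i]+\mathbf u_{\rm vec}[i-T]$. Cut $\mathbf u_{\rm vec}[i]$ and $\mathbf q_{\rm vec}[i]$ into $r$ consecutive blocks $\mathbf u[i,l]$, $\mathbf q[i,l]$, $1\le l\le r$, of length $n$ and a block $\mathbf u[i,r+1]$, $\mathbf q[i,r+1]$ of length $r'$; if $M-2r>1$, cut $\mathbf v_{\rm vec}[i]$ into consecutive blocks $\mathbf v[i,1],\dots,\mathbf v[i,M-2r]$, the first and the last of length $n-r'$ and the others of length $n$. The macro-packet is the $n\times M$ matrix with columns $$\mathbf u[i,1],\dots,\mathbf u[i,r],\begin{bmatrix}\mathbf u[i,r+1]\\ \mathbf v[i,1]\end{bmatrix},\mathbf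 v[i,2],\dots,\mathbf v[i,M-2r-1],\begin{bmatrix}\mathbf q[i,r+1]\\ \mathbf v[i,M-2r]\end{bmatrix},\mathbf q[i,r],\dots,\mathbf q[i,1];$$ if $M-2r=1$, the middle columns are replaced by the single column consisting of $\mathbf u[i,r+1]$, $\mathbf v_{\rm vec}[i]$, $\mathbf q[i,r+1]$ in this order. **Robust code.** Let $N$ be an integer with $0\le N\le\left\lfloor \frac{T}{T+b}Mb\right\rfloor$ and let $$k^s=\left\lceil\frac{Nn}{M(T+1)-N}\right\rceil .$$ Apply a $(k^u+Mk^s,k^u,T)$ Strongly-MDS code to $\mathbf u_{\rm vec}[\cdot]$, split its $Mk^s$ parity checks at time $i$ into $M$ consecutive blocks of length $k^s$, and append the $j$-th block to the $j$-th packet of the $i$-th macro-packet of the burst code. **Proposition.** For all such parameters, every finite field $\mathbb F_q$, and every choice of the two Strongly-MDS codes over $\mathbb F_q$, the robust code is a streaming code with delay $T$ that recovers from any $N$ isolated erasures: there are decoding functions which, for every erasure pattern with at most $N$ erasures (in arbitrary positions) in each window of $W$ consecutive channel packets, compute every source symbol $\mathbf s[i]$ from the channel outputs of the macro-packets $0,\dots,i+T$.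 -/

import Mathlib

namespace StreamingCode

/-! ### Channel, erasure patterns, streaming codes

Packet `j` (with `j = 0, …, M - 1`) of macro-packet `i` is sent in time slot `i * M + j`. -/

/-- Channel output: `none` is the erasure symbol, `E` is the set of erased time slots. -/
noncomputable def received {M : ℕ} {P : Type*} (E : Set ℕ) (X : ℕ → Fin M → P)
    (i : ℕ) (j : Fin M) : Option P :=
  open Classical in if i * M + (j : ℕ) ∈ E then none else some (X i j)

/-- Erasure patterns with at most `N` erasures, in arbitrary positions, in every window of `W`
consecutive channel packets. -/
def isolatedErasures (N W : ℕ) : Set (Set ℕ) :=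
  {E | ∀ t : ℕ, (E ∩ Set.Ico t (t + W)).ncard ≤ N}

/-- `enc` is the encoder of a streaming code with delay `T` (macro-packets) for the given erasure
patterns: macro-packet `i` depends only on the source symbols up to time `i`, and there are
decoding functions that compute the source symbol `i` from the channel outputs of the
macro-packets `0, …, i + T`. -/
def IsStreamingCode {M : ℕ} {S P : Type*} (T : ℕ) (patterns : Set (Set ℕ))
    (enc : (ℕ → S) → ℕ → Fin M → P) : Prop :=
  (∀ (i : ℕ) (s s' : ℕ → S), (∀ t ≤ i, s t = s' t) → enc s i = enc s' i) ∧
  ∃ g : (i : ℕ) → (Fin (i + T + 1) → Fin M → Option P) → S,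
    ∀ E ∈ patterns, ∀ (s : ℕ → S) (i : ℕ),
      g i (fun t j => received E (enc s) t j) = s i

/-! ### Systematic Strongly-MDS convolutional codes -/

/-- Parity checks `p[i] = ∑_{t=0}^{m} s[i-t] H_t` of the systematic `(k + r, k, m)` convolutional
code with parity matrices `H_0, …, H_m`; source symbols with negative index are `0`. -/
def parity {F : Type*} [Field F] {k r : ℕ} (m : ℕ) (H : ℕ → Matrix (Fin k) (Fin r) F)
    (s : ℕ → Fin k → F) (i : ℕ) : Fin r → F :=
  ∑ t ∈ Finset.range (m + 1), if t ≤ i then Matrix.vecMul (s (i - t)) (H t) else 0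

/-- Number of non-zero sub-symbols in the codeword truncated to the times `0, …, j`. -/
noncomputable def truncatedWeight {F : Type*} [Field F] {k r : ℕ} (m : ℕ)
    (H : ℕ → Matrix (Fin k) (Fin r) F) (s : ℕ → Fin k → F) (j : ℕ) : ℕ :=
  open Classical in
  ∑ i ∈ Finset.range (j + 1), (hammingNorm (s i) + hammingNorm (parity m H s i))

/-- The systematic `(k + r, k, m)` code with parity matrices `H` is Strongly-MDS: for
`j = 0, …, m` its `j`-th column distance, the least weight of a truncated codeword with
`s[0] ≠ 0`, attains the upper bound `r (j + 1) + 1` that holds for every such code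
(so only the lower bound has to be required). -/
def IsStronglyMDS {F : Type*} [Field F] {k r : ℕ} (m : ℕ)
    (H : ℕ → Matrix (Fin k) (Fin r) F) : Prop :=
  ∀ j ≤ m, ∀ s : ℕ → Fin k → F, s 0 ≠ 0 → r * (j + 1) + 1 ≤ truncatedWeight m H s j

/-! ### Parameters of the burst code, for bursts of length `B = b * M + B'` -/

/-- The number `n` of sub-symbols in a channel packet of the burst code. -/
def burstN (M T b B' : ℕ) : ℕ :=
  if (B' : ℚ) ≤ (b : ℚ) / (T + b) * M then T + b else T + b + 1

/-- The number `k^u` of sub-symbols of `u_vec`. -/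
def burstKu (M T b B' : ℕ) : ℕ :=
  if (B' : ℚ) ≤ (b : ℚ) / (T + b) * M then M * b else b * M + B'

/-- The number `k^v` of sub-symbols of `v_vec`; the subtractions do not truncate when
`b < T` and `B' < M`. -/
def burstKv (M T b B' : ℕ) : ℕ :=
  if (B' : ℚ) ≤ (b : ℚ) / (T + b) * M then M * (T - b)
  else M * (T + b + 1) - 2 * (b * M + B')

/-! ### The encoder -/

/-- A finite vector read as a sequence (`0` beyond its length). -/
def coords {F : Type*} [Zero F] {k : ℕ} (x : Fin k → F) (l : ℕ) : F :=
  if h : l < k then x ⟨l, h⟩ else 0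

/-- Reshaping: the entry in row `a < n` of column `c < M` of the macro-packet built from `u_vec`
(of length `k^u = r n + r'`), `v_vec` and `q_vec`. Columns and rows are counted from `0`.
* columns `0, …, r - 1` are the length-`n` blocks `u[1], …, u[r]`;
* columns `M - r, …, M - 1` are the length-`n` blocks `q[r], …, q[1]`, in this order;
* column `r` starts with the `r'` remaining entries of `u_vec`, and column `M - r - 1` contains
  the `r'` remaining entries of `q_vec` (on top; if the two columns coincide, at the bottom);
* the remaining places of the columns `r, …, M - r - 1` are filled with `v_vec`. -/
def reshape {F : Type*} (M n ku : ℕ) (u v q : ℕ → F) (c a : ℕ) : F :=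
  let r := ku / n
  let r' := ku % n
  if c < r then u (c * n + a)
  else if M - r ≤ c then q ((M - 1 - c) * n + a)
  else if c = r ∧ a < r' then u (r * n + a)
  else if M - 2 * r = 1 then
    if n - r' ≤ a then q (r * n + (a - (n - r'))) else v (a - r')
  else if c = M - r - 1 then
    if a < r' then q (r * n + a) else v ((c - r) * n - r' + (a - r'))
  else v ((c - r) * n + a - r')

/-- `u_vec[i]`: the first `k^u` sub-symbols of `s[i]`. -/
def uPart {F : Type*} {ku kv : ℕ} (s : ℕ → Fin (ku + kv) → F) (i : ℕ) : Fin ku → F :=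
  fun l => s i (Fin.castAdd kv l)

/-- `v_vec[i]`: the last `k^v` sub-symbols of `s[i]`. -/
def vPart {F : Type*} {ku kv : ℕ} (s : ℕ → Fin (ku + kv) → F) (i : ℕ) : Fin kv → F :=
  fun l => s i (Fin.natAdd ku l)

/-- `q_vec[i] = p_vec[i] + u_vec[i - T]`, where `p_vec` are the parity checks of the
`(k^v + k^u, k^v, T)` code applied to `v_vec`. -/
def qPart {F : Type*} [Field F] {ku kv : ℕ} (T : ℕ)
    (Hv : ℕ → Matrix (Fin kv) (Fin ku) F) (s : ℕ → Fin (ku + kv) → F) (i : ℕ) : Fin ku → F :=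
  parity T Hv (vPart s) i + if T ≤ i then uPart s (i - T) else 0

/-- The burst code: packet `j` of macro-packet `i`, in `F ^ n`. -/
def burstEncode {F : Type*} [Field F] (M n : ℕ) {ku kv : ℕ} (T : ℕ)
    (Hv : ℕ → Matrix (Fin kv) (Fin ku) F) (s : ℕ → Fin (ku + kv) → F) (i : ℕ) (j : Fin M) :
    Fin n → F :=
  fun a => reshape M n ku (coords (uPart s i)) (coords (vPart s i)) (coords (qPart T Hv s i)) j a

/-- The robust code: to packet `j` of macro-packet `i` of the burst code is appended the `j`-th
of the `M` blocks of length `k^s` of `p^u_vec[i]`, the parity checks of the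
`(k^u + M k^s, k^u, T)` code applied to `u_vec`. -/
def robustEncode {F : Type*} [Field F] (M n : ℕ) {ku kv ks : ℕ} (T : ℕ)
    (Hv : ℕ → Matrix (Fin kv) (Fin ku) F) (Hu : ℕ → Matrix (Fin ku) (Fin (M * ks)) F)
    (s : ℕ → Fin (ku + kv) → F) (i : ℕ) (j : Fin M) : Fin (n + ks) → F :=
  Fin.append (burstEncode M n T Hv s i j)
    (fun l : Fin ks => parity T Hu (uPart s) i (finProdFinEquiv (j, l)))

end StreamingCode

/-! Decoding functions exist as soon as the channel outputs up to time `i + T` determine the source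
symbol at `i` (`isStreamingCode_of_determined`). So compare two source sequences with the same
outputs and induct on `i`. Macro-packets `i, …, i + T` fit in one window, hence contain at most `N`
erasures. An erased packet hides at most `n + ks` sub-symbols of the codeword formed by `u_vec` and
its parity checks; the choice of `ks` keeps the total within `M * ks * (T + 1)`, below the column
distance, so `u_vec[i]` is determined. The delayed `u_vec` inside each `q_vec` of the window is then
known and can be cancelled. An erased packet hides at most `n` sub-symbols of `v_vec` and its parity
checks together, and `N * n ≤ ku * (T + 1)` determines `v_vec[i]`. See `eq_of_robustEncode_eq`. -/

namespace StreamingCode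

open Finset

/-! ### Decoding with the column distance -/

section Convolutional

variable {F : Type*} [Field F] {k r : ℕ} {m : ℕ} {H : ℕ → Matrix (Fin k) (Fin r) F}

theorem parity_congr {s s' : ℕ → Fin k → F} {i : ℕ} (h : ∀ t ≤ i, s t = s' t) :
    parity m H s i = parity m H s' i := by
  unfold parity
  refine Finset.sum_congr rfl fun t _ => ?_
  rw [h (i - t) (Nat.sub_le _ _)]

theorem parity_sub (s s' : ℕ → Fin k → F) (i : ℕ) :
    parity m H (s - s') i = parity m H s i - parity m H s' i := by
  unfold parity
  rw [← Finset.sum_sub_distrib]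
  refine Finset.sum_congr rfl fun t _ => ?_
  split_ifs
  · rw [Pi.sub_apply, Matrix.sub_vecMul]
  · simp

/-- Terms reaching back before time `i` vanish; this carries the column distance, stated at time 0,
over to time `i`. -/
theorem parity_shift {s : ℕ → Fin k → F} {i : ℕ} (h : ∀ t < i, s t = 0) (t : ℕ) :
    parity m H (fun j => s (i + j)) t = parity m H s (i + t) := by
  unfold parity
  refine Finset.sum_congr rfl fun τ _ => ?_
  by_cases h1 : τ ≤ t
  · rw [if_pos h1, if_pos (h1.trans (Nat.le_add_left _ _)), Nat.add_sub_assoc h1]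
  · rw [if_neg h1]
    split_ifs with h2
    · rw [h _ (by omega), Matrix.zero_vecMul]
    · rfl

theorem hammingNorm_sub {G : Type*} [AddGroup G] [DecidableEq G] (x y : Fin k → G) :
    hammingNorm (x - y) = hammingDist x y := by
  simp [hammingNorm, hammingDist, sub_eq_zero]

/-- Two inputs of a Strongly-MDS code that agree before time `i`, and whose codewords differ in at
most `r (m + 1)` sub-symbols at the times `i, …, i + m`, agree at time `i`. -/
theorem IsStronglyMDS.eq_of_weight_le [hF : DecidableEq F] (hH : IsStronglyMDS m H) {s s' : ℕ → Fin k → F} {i : ℕ}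
    (h : ∀ t < i, s t = s' t) (e : ℕ → ℕ)
    (he : ∀ t ≤ m, hammingDist (s (i + t)) (s' (i + t)) +
      hammingDist (parity m H s (i + t)) (parity m H s' (i + t)) ≤ e t)
    (hsum : ∑ t ∈ range (m + 1), e t ≤ r * (m + 1)) : s i = s' i := by
  -- `truncatedWeight` counts with the classical instance.
  obtain rfl : hF = fun a b => Classical.propDecidable (a = b) := Subsingleton.elim _ _
  by_contra hne
  have hz : ∀ t < i, (s - s') t = 0 := fun t ht => sub_eq_zero.2 (h t ht)
  have key := hH m le_rfl (fun j => (s - s') (i + j))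
    (by simpa [sub_eq_zero] using hne)
  have hle : truncatedWeight m H (fun j => (s - s') (i + j)) m ≤ ∑ t ∈ range (m + 1), e t := by
    unfold truncatedWeight
    refine Finset.sum_le_sum fun t ht => ?_
    rw [parity_shift hz, parity_sub]
    simp only [Pi.sub_apply, hammingNorm_sub]
    exact he t (by simpa [Nat.lt_succ_iff] using ht)
  omega

end Convolutional

/-! ### Every sub-symbol has a place in the macro-packet -/

section Reshape

/-- The sub-symbol (of `u_vec`, `v_vec` or `q_vec`) that is placed in row `a` of column `c`. -/
def label (M n ku c a : ℕ) : ℕ ⊕ ℕ ⊕ ℕ :=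
  reshape M n ku Sum.inl (Sum.inr ∘ Sum.inl) (Sum.inr ∘ Sum.inr) c a

/-- `reshape` only moves entries, so the layout can be studied on formal symbols. -/
theorem reshape_eq_label {F : Type*} (M n ku : ℕ) (u v q : ℕ → F) (c a : ℕ) :
    reshape M n ku u v q c a = Sum.elim u (Sum.elim v q) (label M n ku c a) := by
  unfold label reshape
  dsimp only
  split_ifs <;> rfl

variable {M n ku kv : ℕ}

theorem two_mul_div_lt (hlt : 2 * ku < n * M) : 2 * (ku / n) < M := by
  have h := Nat.div_add_mod ku n
  by_contra hc
  have := Nat.mul_le_mul_left n (not_lt.1 hc)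
  rw [show n * (2 * (ku / n)) = 2 * (n * (ku / n)) by ring] at this
  omega

theorem exists_label_inl (hlt : 2 * ku < n * M) {l : ℕ} (hl : l < ku) :
    ∃ c < M, ∃ a < n, label M n ku c a = Sum.inl l := by
  have hn : 0 < n := Nat.pos_of_ne_zero (by rintro rfl; simp at hlt)
  have hr := two_mul_div_lt hlt
  have h := Nat.div_add_mod ku n
  have hl' := Nat.div_add_mod l n
  have hle : l / n ≤ ku / n := Nat.div_le_div_right hl.le
  refine ⟨l / n, by omega, l % n, Nat.mod_lt _ hn, ?_⟩
  unfold label reshape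
  dsimp only
  rcases hle.lt_or_eq with h1 | h1
  · rw [if_pos h1, mul_comm, hl']
  · have h2 : l % n < ku % n := by rw [h1] at hl'; omega
    rw [if_neg (by omega), if_neg (by omega), if_pos ⟨h1, h2⟩, ← h1, mul_comm, hl']

theorem exists_label_inr_inr (hlt : 2 * ku < n * M) {l : ℕ} (hl : l < ku) :
    ∃ c < M, ∃ a < n, label M n ku c a = Sum.inr (Sum.inr l) := by
  have hn : 0 < n := Nat.pos_of_ne_zero (by rintro rfl; simp at hlt)
  have hr := two_mul_div_lt hlt
  have h := Nat.div_add_mod ku n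
  have hl' := Nat.div_add_mod l n
  have hmod := Nat.mod_lt ku hn
  have hle : l / n ≤ ku / n := Nat.div_le_div_right hl.le
  have hmodl := Nat.mod_lt l hn
  rcases hle.lt_or_eq with h1 | h1
  · have h0 : M - 1 - l / n < M ∧ M - ku / n ≤ M - 1 - l / n ∧ ¬ M - 1 - l / n < ku / n ∧
        M - 1 - (M - 1 - l / n) = l / n := by
      clear hl' h
      generalize l / n = x at *
      omega
    refine ⟨M - 1 - l / n, h0.1, l % n, hmodl, ?_⟩
    unfold label reshape
    dsimp only
    rw [if_neg h0.2.2.1, if_pos h0.2.1, h0.2.2.2, mul_comm, hl']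
    rfl
  · have h2 : l % n < ku % n := by rw [h1] at hl'; omega
    by_cases hM : M - 2 * (ku / n) = 1
    · have hM' : M = 2 * (ku / n) + 1 := by omega
      -- In a single middle column, the remainders of `u_vec` (top) and `q_vec` (bottom) do not
      -- overlap.
      have h3 : 2 * (ku % n) < n := by
        generalize ku / n = r at *
        subst hM'
        nlinarith
      refine ⟨ku / n, by omega, n - ku % n + l % n, by omega, ?_⟩
      unfold label reshape
      dsimp only
      rw [if_neg (by omega), if_neg (by omega), if_neg (by omega), if_pos hM, if_pos (by omega),
        Nat.add_sub_cancel_left, ← h1, mul_comm, hl']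
      rfl
    · refine ⟨M - ku / n - 1, by omega, l % n, hmodl, ?_⟩
      unfold label reshape
      dsimp only
      rw [if_neg (by omega), if_neg (by omega), if_neg (by omega), if_neg hM, if_pos rfl,
        if_pos h2, ← h1, mul_comm, hl']
      rfl

theorem exists_label_inr_inl (hk : 2 * ku + kv = n * M) {l : ℕ} (hl : l < kv) :
    ∃ c < M, ∃ a < n, label M n ku c a = Sum.inr (Sum.inl l) := by
  have hlt : 2 * ku < n * M := by omega
  have hn : 0 < n := Nat.pos_of_ne_zero (by rintro rfl; simp at hlt)
  have hr := two_mul_div_lt hlt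
  have h := Nat.div_add_mod ku n
  have hmod := Nat.mod_lt ku hn
  by_cases hM : M - 2 * (ku / n) = 1
  · have hM' : M = 2 * (ku / n) + 1 := by omega
    have h3 : 2 * (ku % n) + kv = n := by
      generalize ku / n = r at *
      subst hM'
      nlinarith
    refine ⟨ku / n, by omega, l + ku % n, by omega, ?_⟩
    unfold label reshape
    dsimp only
    rw [if_neg (by omega), if_neg (by omega), if_neg (by omega), if_pos hM, if_neg (by omega),
      Nat.add_sub_cancel]
    rfl
  · obtain ⟨d, hd⟩ : ∃ d, M = 2 * (ku / n) + 1 + d := ⟨M - 2 * (ku / n) - 1, by omega⟩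
    -- The `d + 1` middle columns hold `v_vec` and both remainders.
    have hkv : kv + 2 * (ku % n) = d * n + n := by
      generalize ku / n = r at *
      subst hd
      nlinarith
    -- Read down the middle columns, entry `l` of `v_vec` is at position `l + ku % n`, after the
    -- remainder of `u_vec`. In the last of them the remainder of `q_vec` on top shifts it by
    -- another `ku % n`.
    by_cases hx : l + ku % n < d * n
    · have hc : (l + ku % n) / n < d := Nat.div_lt_of_lt_mul (by rwa [mul_comm])
      have hx' := Nat.div_add_mod (l + ku % n) n
      refine ⟨ku / n + (l + ku % n) / n, by omega, (l + ku % n) % n, Nat.mod_lt _ hn, ?_⟩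
      have h4 : ¬ (ku / n + (l + ku % n) / n = ku / n ∧ (l + ku % n) % n < ku % n) := by
        rintro ⟨h5, h6⟩
        rw [Nat.add_eq_left.1 h5, mul_zero] at hx'
        omega
      have h5 : ¬ ku / n + (l + ku % n) / n < ku / n ∧ ¬ M - ku / n ≤ ku / n + (l + ku % n) / n ∧
          ku / n + (l + ku % n) / n ≠ M - ku / n - 1 := by
        clear hx' h h4
        generalize (l + ku % n) / n = x at *
        omega
      unfold label reshape
      dsimp only
      rw [if_neg h5.1, if_neg h5.2.1, if_neg h4, if_neg hM, if_neg h5.2.2,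
        Nat.add_sub_cancel_left, mul_comm, hx', Nat.add_sub_cancel]
      rfl
    · refine ⟨M - ku / n - 1, by omega, l + ku % n - d * n + ku % n, by omega, ?_⟩
      unfold label reshape
      dsimp only
      -- Here `d ≥ 1`, so the subtraction in `reshape` does not truncate.
      have h4 : ku % n ≤ d * n := hmod.le.trans (Nat.le_mul_of_pos_left _ (by omega))
      rw [if_neg (by omega), if_neg (by omega), if_neg (by omega), if_neg hM, if_pos rfl,
        if_neg (by omega), show M - ku / n - 1 - ku / n = d by omega,
        show d * n - ku % n + (l + ku % n - d * n + ku % n - ku % n) = l by omega]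
      rfl

end Reshape

/-- Sub-symbols with labels `ι` that are spread over packets of `n` places: if only sub-symbols
in the packets `J` can be bad, at most `#J * n` of them are bad. -/
theorem card_le_of_label {ι L : Type*} {M n : ℕ} (A : Finset ι) (J : Finset (Fin M))
    (lab : ℕ → ℕ → L) (f : ι → L) (hf : Function.Injective f)
    (h : ∀ x ∈ A, ∃ c ∈ J, ∃ a < n, lab c a = f x) : #A ≤ #J * n := by
  classical
  have : A.map ⟨f, hf⟩ ⊆ (J ×ˢ range n).image fun p => lab p.1 p.2 := by
    intro y hy
    obtain ⟨x, hx, rfl⟩ := Finset.mem_map.1 hy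
    obtain ⟨c, hc, a, ha, hl⟩ := h x hx
    exact Finset.mem_image.2 ⟨(c, a), by simp [hc, ha], hl⟩
  calc #A = #(A.map ⟨f, hf⟩) := (Finset.card_map _).symm
    _ ≤ #((J ×ˢ range n).image fun p => lab p.1 p.2) := Finset.card_le_card this
    _ ≤ #(J ×ˢ range n) := Finset.card_image_le
    _ = #J * n := by rw [Finset.card_product, Finset.card_range]

/-! ### Erasures and decodability -/

section Channel

open Classical in
/-- The packets of macro-packet `i` that are erased. -/
noncomputable def erased (M : ℕ) (E : Set ℕ) (i : ℕ) : Finset (Fin M) :=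
  {j | i * M + (j : ℕ) ∈ E}

/-- These macro-packets occupy `M * (T + 1)` consecutive slots from `i * M` on, and division by `M`
recovers macro-packet and packet from the slot. -/
theorem sum_card_erased_le {M T W N : ℕ} (hW : M * (T + 1) ≤ W) {E : Set ℕ}
    (hE : E ∈ isolatedErasures N W) (i : ℕ) :
    ∑ t ∈ range (T + 1), #(erased M E (i + t)) ≤ N := by
  classical
  refine le_trans ?_ (hE (i * M))
  rw [← Finset.card_sigma, ← Set.ncard_coe_finset]
  refine Set.ncard_le_ncard_of_injOn (fun p => (i + p.1) * M + (p.2 : ℕ)) ?_ ?_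
    ((Set.finite_Ico _ _).subset Set.inter_subset_right)
  · rintro ⟨t, j⟩ h
    simp only [Finset.mem_coe, Finset.mem_sigma, Finset.mem_range, erased, Finset.mem_filter,
      Finset.mem_univ, true_and] at h
    have := j.2
    refine ⟨h.2, ?_, ?_⟩
    · dsimp only
      nlinarith
    · dsimp only
      nlinarith [h.1]
  · rintro ⟨t, j⟩ - ⟨t', j'⟩ - h
    dsimp only at h
    have hM : 0 < M := j.pos
    have h1 := congrArg (· / M) h
    have h2 := congrArg (· % M) h
    simp only [add_comm _ (j : ℕ), add_comm _ (j' : ℕ), Nat.add_mul_div_right _ _ hM,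
      Nat.div_eq_of_lt j.2, Nat.div_eq_of_lt j'.2, Nat.add_mul_mod_self_right,
      Nat.mod_eq_of_lt j.2, Nat.mod_eq_of_lt j'.2] at h1 h2
    obtain rfl : t = t' := by omega
    obtain rfl : j = j' := Fin.ext h2
    rfl

variable {M : ℕ} {P : Type*}

theorem eq_of_received_eq {E E' : Set ℕ} {X X' : ℕ → Fin M → P} {i : ℕ} {j : Fin M}
    (h : received E X i j = received E' X' i j) (hj : j ∉ erased M E i) : X i j = X' i j := by
  classical
  have hj' : i * M + (j : ℕ) ∉ E := by simpa [erased] using hj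
  unfold received at h
  rw [if_neg hj'] at h
  split_ifs at h
  exact Option.some.inj h

/-- The decoder picks any admissible pattern and source consistent with the output; any choice gives
the same symbol at time `i`. -/
theorem isStreamingCode_of_determined {S : Type*} [Nonempty S] {T : ℕ} {patterns : Set (Set ℕ)}
    {enc : (ℕ → S) → ℕ → Fin M → P}
    (hcausal : ∀ (i : ℕ) (s s' : ℕ → S), (∀ t ≤ i, s t = s' t) → enc s i = enc s' i)
    (hdet : ∀ E ∈ patterns, ∀ E' ∈ patterns, ∀ (s s' : ℕ → S) (i : ℕ),
      (∀ t ≤ i + T, ∀ j, received E (enc s) t j = received E' (enc s') t j) → s i = s' i) :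
    IsStreamingCode T patterns enc := by
  classical
  refine ⟨hcausal, fun i y =>
    if h : ∃ p : Set ℕ × (ℕ → S), p.1 ∈ patterns ∧
      (fun (t : Fin (i + T + 1)) j => received p.1 (enc p.2) t j) = y
    then h.choose.2 i else Classical.arbitrary S, fun E hE s i => ?_⟩
  have h : ∃ p : Set ℕ × (ℕ → S), p.1 ∈ patterns ∧
      (fun (t : Fin (i + T + 1)) j => received p.1 (enc p.2) t j) =
        fun (t : Fin (i + T + 1)) j => received E (enc s) t j := ⟨(E, s), hE, rfl⟩
  dsimp only
  rw [dif_pos h]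
  refine hdet _ h.choose_spec.1 _ hE _ _ _ fun t ht j => ?_
  exact congrFun (congrFun h.choose_spec.2 ⟨t, by omega⟩) j

end Channel

/-! ### Decoding the robust code -/

section Robust

variable {F : Type*} [Field F] {M n ku kv ks T : ℕ}
  {Hv : ℕ → Matrix (Fin kv) (Fin ku) F} {Hu : ℕ → Matrix (Fin ku) (Fin (M * ks)) F}

theorem qPart_congr {s s' : ℕ → Fin (ku + kv) → F} {i : ℕ} (h : ∀ t ≤ i, s t = s' t) :
    qPart T Hv s i = qPart T Hv s' i := by
  unfold qPart
  have hp : parity T Hv (vPart s) i = parity T Hv (vPart s') i :=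
    parity_congr fun t ht => by unfold vPart; rw [h t ht]
  have hu : uPart s (i - T) = uPart s' (i - T) := by
    unfold uPart; rw [h _ (Nat.sub_le _ _)]
  rw [hp, hu]

theorem robustEncode_congr {s s' : ℕ → Fin (ku + kv) → F} {i : ℕ} (h : ∀ t ≤ i, s t = s' t) :
    robustEncode M n T Hv Hu s i = robustEncode M n T Hv Hu s' i := by
  have hu : ∀ t ≤ i, uPart s t = uPart s' t := fun t ht => by unfold uPart; rw [h t ht]
  have hv : vPart s i = vPart s' i := by unfold vPart; rw [h i le_rfl]
  funext j
  unfold robustEncode burstEncode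
  rw [hu i le_rfl, hv, qPart_congr h, parity_congr hu]

/-- Sub-symbols of the burst part of two equal packets agree. -/
theorem elim_label_eq {s s' : ℕ → Fin (ku + kv) → F} {i : ℕ} {j : Fin M}
    (h : robustEncode M n T Hv Hu s i j = robustEncode M n T Hv Hu s' i j) {a : ℕ} (ha : a < n) :
    Sum.elim (coords (uPart s i)) (Sum.elim (coords (vPart s i)) (coords (qPart T Hv s i)))
        (label M n ku j a) =
      Sum.elim (coords (uPart s' i)) (Sum.elim (coords (vPart s' i)) (coords (qPart T Hv s' i)))
        (label M n ku j a) := by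
  have := congrFun h (Fin.castAdd ks ⟨a, ha⟩)
  unfold robustEncode burstEncode at this
  rw [Fin.append_left, Fin.append_left] at this
  rw [← reshape_eq_label, ← reshape_eq_label]
  exact this

theorem coords_val {k : ℕ} (x : Fin k → F) (l : Fin k) : coords x l = x l := by
  simp [coords]

variable {s s' : ℕ → Fin (ku + kv) → F} {i : ℕ} {J : Finset (Fin M)}

theorem hammingDist_uPart_le [DecidableEq F] (hlt : 2 * ku < n * M)
    (h : ∀ j ∉ J, robustEncode M n T Hv Hu s i j = robustEncode M n T Hv Hu s' i j) :
    hammingDist (uPart s i) (uPart s' i) ≤ #J * n := by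
  refine card_le_of_label _ J (label M n ku) (fun l : Fin ku => Sum.inl (l : ℕ))
    (fun x y hxy => Fin.ext (Sum.inl.inj hxy)) fun l hl => ?_
  obtain ⟨c, hc, a, ha, hlab⟩ := exists_label_inl hlt l.2
  refine ⟨⟨c, hc⟩, ?_, a, ha, hlab⟩
  by_contra hJ
  have := elim_label_eq (h _ hJ) ha
  simp only [hlab, Sum.elim_inl, coords_val] at this
  simp [this] at hl

theorem hammingDist_parity_uPart_le [DecidableEq F]
    (h : ∀ j ∉ J, robustEncode M n T Hv Hu s i j = robustEncode M n T Hv Hu s' i j) :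
    hammingDist (parity T Hu (uPart s) i) (parity T Hu (uPart s') i) ≤ #J * ks := by
  refine card_le_of_label _ J (fun c a => (c, a))
    (fun x : Fin (M * ks) => (((finProdFinEquiv.symm x).1 : ℕ), ((finProdFinEquiv.symm x).2 : ℕ)))
    (fun x y hxy => ?_) fun x hx => ?_
  · apply finProdFinEquiv.symm.injective
    exact Prod.ext (Fin.ext (Prod.ext_iff.1 hxy).1) (Fin.ext (Prod.ext_iff.1 hxy).2)
  · refine ⟨(finProdFinEquiv.symm x).1, ?_, (finProdFinEquiv.symm x).2, Fin.is_lt _, rfl⟩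
    by_contra hJ
    have := congrFun (h _ hJ) (Fin.natAdd n (finProdFinEquiv.symm x).2)
    unfold robustEncode at this
    rw [Fin.append_right, Fin.append_right, Prod.mk.eta, Equiv.apply_symm_apply] at this
    simp [this] at hx

/-- Once the delayed `u_vec` agree, differences of parity checks are differences of `q_vec`. As
`v_vec` and `q_vec` have distinct labels, both distances share the same `n` places per packet. -/
theorem hammingDist_vPart_add_le [DecidableEq F] (hk : 2 * ku + kv = n * M) (hlt : 2 * ku < n * M)
    (hu : T ≤ i → uPart s (i - T) = uPart s' (i - T))
    (h : ∀ j ∉ J, robustEncode M n T Hv Hu s i j = robustEncode M n T Hv Hu s' i j) :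
    hammingDist (vPart s i) (vPart s' i) +
      hammingDist (parity T Hv (vPart s) i) (parity T Hv (vPart s') i) ≤ #J * n := by
  unfold hammingDist
  rw [← Finset.card_disjSum]
  refine card_le_of_label _ J (label M n ku)
    (fun x : Fin kv ⊕ Fin ku => Sum.inr (Sum.map Fin.val Fin.val x))
    (fun x y hxy => Function.Injective.sumMap Fin.val_injective Fin.val_injective
      (Sum.inr.inj hxy)) ?_
  rintro (l | l) hl
  · obtain ⟨c, hc, a, ha, hlab⟩ := exists_label_inr_inl hk l.2
    refine ⟨⟨c, hc⟩, ?_, a, ha, hlab⟩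
    by_contra hJ
    have := elim_label_eq (h _ hJ) ha
    simp only [hlab, Sum.elim_inl, Sum.elim_inr, coords_val] at this
    simp [this] at hl
  · obtain ⟨c, hc, a, ha, hlab⟩ := exists_label_inr_inr hlt l.2
    refine ⟨⟨c, hc⟩, ?_, a, ha, hlab⟩
    by_contra hJ
    have := elim_label_eq (h _ hJ) ha
    simp only [hlab, Sum.elim_inr, coords_val, qPart, Pi.add_apply] at this
    have he : (if T ≤ i then uPart s (i - T) else 0) =
        if T ≤ i then uPart s' (i - T) else 0 := by
      split_ifs with hT
      exacts [hu hT, rfl]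
    rw [he] at this
    simp [add_right_cancel this] at hl

/-- Inputs of the robust code with the same channel outputs agree, provided that the erasures are
few enough for both Strongly-MDS codes. -/
theorem eq_of_robustEncode_eq {N W : ℕ} (hW : M * (T + 1) ≤ W)
    (hk : 2 * ku + kv = n * M) (hkv : 0 < kv)
    (hNu : N * (n + ks) ≤ M * ks * (T + 1)) (hNv : N * n ≤ ku * (T + 1))
    (hHv : IsStronglyMDS T Hv) (hHu : IsStronglyMDS T Hu)
    {E : Set ℕ} (hE : E ∈ isolatedErasures N W) (i : ℕ)
    (h : ∀ t ≤ i + T, ∀ j ∉ erased M E t,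
      robustEncode M n T Hv Hu s t j = robustEncode M n T Hv Hu s' t j) : s i = s' i := by
  classical
  induction i using Nat.strong_induction_on with
  | _ i ih =>
  have hprev : ∀ t < i, s t = s' t := fun t ht => ih t ht fun t' ht' => h t' (by omega)
  have hsum := sum_card_erased_le hW hE i
  have hu : uPart s i = uPart s' i := by
    refine hHu.eq_of_weight_le (fun t ht => by unfold uPart; rw [hprev t ht])
      (fun t => #(erased M E (i + t)) * (n + ks)) (fun t ht => ?_) ?_
    · rw [mul_add]
      exact add_le_add
        (hammingDist_uPart_le (by omega) (h (i + t) (by omega)))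
        (hammingDist_parity_uPart_le (h (i + t) (by omega)))
    · rw [← Finset.sum_mul]
      exact (Nat.mul_le_mul_right _ hsum).trans hNu
  have hv : vPart s i = vPart s' i := by
    refine hHv.eq_of_weight_le (fun t ht => by unfold vPart; rw [hprev t ht])
      (fun t => #(erased M E (i + t)) * n) (fun t ht => ?_) ?_
    · refine hammingDist_vPart_add_le hk (by omega) (fun _ => ?_) (h (i + t) (by omega))
      -- As `t ≤ T`, the delayed time is at most `i`: earlier times are covered by induction, time
      -- `i` by `hu`.
      rcases Nat.lt_or_ge (i + t - T) i with h1 | h1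
      · unfold uPart
        rw [hprev _ h1]
      · rw [show i + t - T = i by omega, hu]
    · rw [← Finset.sum_mul]
      exact (Nat.mul_le_mul_right _ hsum).trans hNv
  funext l
  refine Fin.addCases (fun l => ?_) (fun l => ?_) l
  exacts [congrFun hu l, congrFun hv l]

end Robust

/-! ### Arithmetic of the parameters -/

section Parameters

variable {M T b B' : ℕ}

theorem two_mul_burstKu_add_burstKv (hT : b < T) (hB' : B' < M) :
    2 * burstKu M T b B' + burstKv M T b B' = burstN M T b B' * M ∧ 0 < burstKv M T b B' := by
  obtain ⟨d, rfl⟩ : ∃ d, T = b + 1 + d := ⟨T - (b + 1), by omega⟩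
  unfold burstKu burstKv burstN
  split_ifs with h
  · rw [show b + 1 + d - b = d + 1 by omega]
    exact ⟨by ring, Nat.mul_pos (by omega) (by omega)⟩
  · have : 2 * (b * M + B') < M * (b + 1 + d + b + 1) := by nlinarith [Nat.zero_le (M * d)]
    refine ⟨?_, Nat.sub_pos_of_lt this⟩
    rw [Nat.add_sub_cancel' this.le, mul_comm]

theorem mul_burstN_le {N : ℕ} (hT : b < T) (hN : N ≤ ⌊(T : ℚ) / (T + b) * (M * b)⌋₊) :
    N * burstN M T b B' ≤ burstKu M T b B' * T := by
  have hpos : (0 : ℚ) < T + b := by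
    have : (0 : ℚ) < T := by exact_mod_cast (Nat.zero_le b).trans_lt hT
    positivity
  have hN' : (N : ℚ) ≤ T / (T + b) * (M * b) := (Nat.le_floor_iff (by positivity)).1 hN
  have h1 : (N : ℚ) * (T + b) ≤ T * (M * b) := by
    rw [div_mul_eq_mul_div, le_div_iff₀ hpos] at hN'
    exact hN'
  unfold burstKu burstN
  split_ifs with h
  · have : ((N * (T + b) : ℕ) : ℚ) ≤ ((M * b * T : ℕ) : ℚ) := by push_cast; linarith
    exact_mod_cast this
  · have h2 : (b : ℚ) * M ≤ B' * (T + b) := by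
      rw [not_le, div_mul_eq_mul_div, div_lt_iff₀ hpos] at h
      exact h.le
    -- Multiplying `h1` by `T + b + 1` leaves an excess `T * M * b`, which the case condition `h2`
    -- bounds by `T * B' * (T + b)`.
    have h3 : (N : ℚ) * (T + b + 1) * (T + b) ≤ (b * M + B') * T * (T + b) := by
      have e1 := mul_le_mul_of_nonneg_right h1 (by positivity : (0 : ℚ) ≤ T + b + 1)
      have e2 := mul_le_mul_of_nonneg_right h2 (by positivity : (0 : ℚ) ≤ T)
      linarith
    have h4 := le_of_mul_le_mul_right h3 hpos
    have : ((N * (T + b + 1) : ℕ) : ℚ) ≤ (((b * M + B') * T : ℕ) : ℚ) := by push_cast; exact h4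
    exact_mod_cast this

/-- This is the inequality defining `ks` with the denominator cleared; the denominator is positive
because `N ≤ M * T`. -/
theorem mul_add_ceil_le {N n : ℕ} (hM : 0 < M) (hT : b < T)
    (hN : N ≤ ⌊(T : ℚ) / (T + b) * (M * b)⌋₊) :
    N * (n + ⌈((N : ℚ) * n) / (M * (T + 1) - N)⌉₊) ≤
      M * ⌈((N : ℚ) * n) / (M * (T + 1) - N)⌉₊ * (T + 1) := by
  have hT0 : (0 : ℚ) < T := by exact_mod_cast (Nat.zero_le b).trans_lt hT
  have hM0 : (0 : ℚ) < M := by exact_mod_cast hM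
  have hN' : (N : ℚ) ≤ T / (T + b) * (M * b) := (Nat.le_floor_iff (by positivity)).1 hN
  have h1 : (N : ℚ) ≤ M * T := by
    refine hN'.trans ?_
    rw [div_mul_eq_mul_div, div_le_iff₀ (by positivity)]
    nlinarith [mul_pos (mul_pos hM0 hT0) hT0]
  have hpos : (0 : ℚ) < M * (T + 1) - N := by linarith
  have h2 := Nat.le_ceil (((N : ℚ) * n) / (M * (T + 1) - N))
  generalize ⌈((N : ℚ) * n) / (M * (T + 1) - N)⌉₊ = ks at h2 ⊢
  rw [div_le_iff₀ hpos] at h2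
  have : ((N * (n + ks) : ℕ) : ℚ) ≤ ((M * ks * (T + 1) : ℕ) : ℚ) := by push_cast; linarith
  exact_mod_cast this

end Parameters

end StreamingCode

theorem proposition3 {F : Type*} [Field F] [Finite F]
    (M T W b B' N n ku kv ks : ℕ)
    (hM : 1 < M) (hW : M * (T + 1) ≤ W) (hT : b < T) (hB' : B' < M)
    (hn : n = StreamingCode.burstN M T b B')
    (hku : ku = StreamingCode.burstKu M T b B')
    (hkv : kv = StreamingCode.burstKv M T b B')
    (hN : N ≤ ⌊(T : ℚ) / (T + b) * (M * b)⌋₊)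
    (hks : ks = ⌈((N : ℚ) * n) / (M * (T + 1) - N)⌉₊)
    (Hv : ℕ → Matrix (Fin kv) (Fin ku) F) (hHv : StreamingCode.IsStronglyMDS T Hv)
    (Hu : ℕ → Matrix (Fin ku) (Fin (M * ks)) F) (hHu : StreamingCode.IsStronglyMDS T Hu) :
    StreamingCode.IsStreamingCode T (StreamingCode.isolatedErasures N W)
      (StreamingCode.robustEncode M n T Hv Hu) := by
  subst hn hku hkv hks
  obtain ⟨hk, hkv⟩ := StreamingCode.two_mul_burstKu_add_burstKv hT hB'
  refine StreamingCode.isStreamingCode_of_determined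
    (fun i s s' h => StreamingCode.robustEncode_congr h) fun E hE E' _ s s' i h => ?_
  exact StreamingCode.eq_of_robustEncode_eq hW hk hkv
    (StreamingCode.mul_add_ceil_le (by omega) hT hN)
    ((StreamingCode.mul_burstN_le hT hN).trans (Nat.mul_le_mul_left _ (Nat.le_succ T)))
    hHv hHu hE i fun t ht j hj => StreamingCode.eq_of_received_eq (h t ht j) hj
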